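/- There are $n$ persons, each of whom initially knows exactly one gossip of his own (different persons know different gossips). In a telephone call two different persons tell each other all the gossips they know at that moment; calls are made one after another. For $2\le k\le n$ let $P(n,k)$ be the minimum number of calls in a finite sequence of calls after which each of the $n$ persons knows at least $k$ gossips (his own included). For an integer $k\ge 4$ and integers $-1\le i\le k-4$ put $t_i(k)=i+2^{k-i-2}$. Let $n$, $k$, $i$ be integers with $0\le i\le k-4$ and $t_i(k)\le n<t_{i-1}(k)$. Then $P(n,k)=n+i$. -/

import Mathlib

namespace PartialGossip

/-- The telephone call `c` between the persons `c.1` and `c.2`: `K v` is the set of gossips that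
person `v` knows before the call; after it, both participants know everything that either of them
knew, and nobody else learns anything. -/
def call {V : Type*} [DecidableEq V] (K : V → Finset V) (c : V × V) : V → Finset V :=
  fun v => if v = c.1 ∨ v = c.2 then K c.1 ∪ K c.2 else K v

/-- The gossips known to each person when all the calls of the list `s` have been made, in the order
of the list. At the beginning each person knows exactly his own gossip. -/
def knowledge {V : Type*} [DecidableEq V] (s : List (V × V)) : V → Finset V :=
  s.foldl call (fun v => {v})

/-- A communication scheme is a finite sequence of calls, each between two different persons. -/
def IsScheme {V : Type*} (s : List (V × V)) : Prop :=
  ∀ c ∈ s, c.1 ≠ c.2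

/-- Every person knows at least `k` gossips when all the calls are completed. -/
def IsInforming {V : Type*} [DecidableEq V] (k : ℕ) (s : List (V × V)) : Prop :=
  ∀ v : V, k ≤ (knowledge s v).card

/-- The minimum number of calls needed for each of `n` persons to know at least `k` gossips.
(For `k ≤ n` such schemes exist; the infimum of the empty set is `0` by convention.) -/
noncomputable def P (n k : ℕ) : ℕ :=
  sInf {m : ℕ | ∃ s : List (Fin n × Fin n), IsScheme s ∧ IsInforming k s ∧ s.length = m}

/-- `t k i = i + 2 ^ (k - i - 2)`, for `-1 ≤ i ≤ k - 4`; the exponent, computed in the integers,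
is at least `2` in that range. -/
def t (k : ℕ) (i : ℤ) : ℤ :=
  i + 2 ^ ((k : ℤ) - i - 2).toNat

end PartialGossip

/-!
Trace the calls backwards from the end: a set `L` of persons owes its knowledge to the gossips that
reach it and to the calls that influence it. Suppose that fewer than `|L| + j` calls influence `L`,
all of whose members learn `k` gossips, and take such an `L` minimal. Going back in time, the calls
inside `L` merge its members into clusters, each joined by a spanning tree of calls, until two
clusters `A`, `B` remain; by minimality exactly `j + 1` earlier calls influence them, and these
calls are the same for `A` and `B`. A cluster influenced by `w` earlier calls with `τ` participants
has at least `2 ^ (k - 1 - w) - min 2 (τ - w)` members who make none of these calls: when two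
clusters merge, either both see one influencing call more than their union, which doubles the
bound, or one of them satisfies the bound for the union already. The proper subset `B` is influenced
by fewer than `|B| + (j + 1)` calls, so induction bounds the number of gossips that reach it, and
the members of `A` that make no earlier calls double this bound: at least `j + 2 ^ (k - j - 1) - 1`
gossips reach `L`.

Conversely, four persons exchange all their gossips in four calls. Doubling the persons at the cost
of one call for each new person, then adding `i` persons who make both the first and the last call,
each of which raises `k` by one, and finally persons who only call at the end, attains `n + i`.
-/

namespace PartialGossip

section Influence

variable {V : Type*} [DecidableEq V] {c : V × V} {l F : List (V × V)} {X Y : Finset V} {v : V}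

/-- The two persons who take part in the call `c`. -/
def ends (c : V × V) : Finset V := {c.1, c.2}

/-- The persons who take part in some call of the list `s`. -/
def participants (s : List (V × V)) : Finset V := s.toFinset.biUnion ends

/-- The persons whose knowledge before the call `c` makes up what the members of `X` know after
it. -/
def sources (X : Finset V) (c : V × V) : Finset V :=
  if Disjoint (ends c) X then X else ends c ∪ X

/-- The persons whose gossips reach the set `X` through the calls of `l`. The calls are traced
backwards in time, so `l` lists the latest call first. -/
def reach (l : List (V × V)) (X : Finset V) : Finset V := l.foldl sources X

/-- The calls of `l` (latest call first) that influence what the members of `X` finally know. -/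
def influencing : List (V × V) → Finset V → List (V × V)
  | [], _ => []
  | c :: l, X =>
    if Disjoint (ends c) X then influencing l X else c :: influencing l (ends c ∪ X)

/-- The number of calls of `l` (latest call first) that influence what the members of `X` finally
know. -/
def influenceCount (l : List (V × V)) (X : Finset V) : ℕ := (influencing l X).length

theorem mem_ends : v ∈ ends c ↔ v = c.1 ∨ v = c.2 := by
  simp [ends]

theorem disjoint_ends : Disjoint (ends c) X ↔ c.1 ∉ X ∧ c.2 ∉ X := by
  simp [ends]

theorem ends_subset : ends c ⊆ X ↔ c.1 ∈ X ∧ c.2 ∈ X := by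
  simp [ends, Finset.insert_subset_iff]

theorem card_ends_le (c : V × V) : (ends c).card ≤ 2 := Finset.card_le_two

theorem participants_cons (c : V × V) (l : List (V × V)) :
    participants (c :: l) = ends c ∪ participants l := by
  simp [participants]

theorem participants_subset_of_sublist {s t : List (V × V)} (h : s.Sublist t) :
    participants s ⊆ participants t :=
  Finset.biUnion_subset_biUnion_of_subset_left _ fun _ hc =>
    List.mem_toFinset.2 (h.subset (List.mem_toFinset.1 hc))

theorem sources_of_disjoint (h : Disjoint (ends c) X) : sources X c = X := if_pos h

theorem sources_of_not_disjoint (h : ¬Disjoint (ends c) X) : sources X c = ends c ∪ X := if_neg h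

theorem sources_mono (c : V × V) (h : X ⊆ Y) : sources X c ⊆ sources Y c := by
  unfold sources
  split_ifs with hX hY hY
  · exact h
  · exact h.trans Finset.subset_union_right
  · exact absurd (hY.mono_right h) hX
  · exact Finset.union_subset_union_right h

theorem sources_union (X Y : Finset V) (c : V × V) :
    sources (X ∪ Y) c = sources X c ∪ sources Y c := by
  simp only [sources, Finset.disjoint_union_right]
  grind

theorem card_sources_le (h : ¬Disjoint (ends c) X) : (sources X c).card ≤ X.card + 1 := by
  rw [sources_of_not_disjoint h]
  have hinter := Finset.card_pos.2 (Finset.not_disjoint_iff_nonempty_inter.1 h)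
  have hunion := Finset.card_union_add_card_inter (ends c) X
  have hends := card_ends_le c
  omega

theorem reach_cons (c : V × V) (l : List (V × V)) (X : Finset V) :
    reach (c :: l) X = reach l (sources X c) := rfl

theorem reach_append (F l : List (V × V)) (X : Finset V) :
    reach (F ++ l) X = reach l (reach F X) :=
  List.foldl_append

theorem reach_mono (l : List (V × V)) (h : X ⊆ Y) : reach l X ⊆ reach l Y := by
  induction l generalizing X Y with
  | nil => exact h
  | cons c _ ih => exact ih (sources_mono c h)

theorem reach_union (l : List (V × V)) (X Y : Finset V) :
    reach l (X ∪ Y) = reach l X ∪ reach l Y := by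
  induction l generalizing X Y with
  | nil => rfl
  | cons c l ih => simp only [reach_cons, sources_union, ih]

theorem knowledge_eq_reach (s : List (V × V)) (v : V) : knowledge s v = reach s.reverse {v} := by
  induction s using List.reverseRecOn generalizing v with
  | nil => rfl
  | append_singleton s c ih =>
    have hcall : knowledge (s ++ [c]) v = call (knowledge s) c v := by
      simp only [knowledge, List.foldl_append, List.foldl_cons, List.foldl_nil]
    rw [hcall, List.reverse_append, List.reverse_singleton, List.singleton_append, reach_cons]
    by_cases hv : v ∈ ends c
    · have hsources : sources {v} c = {c.1} ∪ {c.2} := by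
        rw [sources_of_not_disjoint (by simpa using hv),
          Finset.union_eq_left.2 (Finset.singleton_subset_iff.2 hv)]
        rfl
      rw [call, if_pos (mem_ends.1 hv), ih, ih, hsources, reach_union]
    · rw [call, if_neg (mt mem_ends.2 hv), ih, sources_of_disjoint (by simpa using hv)]

theorem influencing_cons_of_disjoint (h : Disjoint (ends c) X) :
    influencing (c :: l) X = influencing l X := if_pos h

theorem influencing_cons_of_not_disjoint (h : ¬Disjoint (ends c) X) :
    influencing (c :: l) X = c :: influencing l (ends c ∪ X) := if_neg h

theorem influencing_sublist (l : List (V × V)) (X : Finset V) : (influencing l X).Sublist l := by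
  induction l generalizing X with
  | nil => exact List.Sublist.refl _
  | cons c l ih =>
    rw [influencing]
    split_ifs
    · exact (ih X).cons c
    · exact (ih _).cons_cons c

theorem influencing_sublist_of_subset (l : List (V × V)) (h : X ⊆ Y) :
    (influencing l X).Sublist (influencing l Y) := by
  induction l generalizing X Y with
  | nil => exact List.Sublist.refl _
  | cons c l ih =>
    simp only [influencing]
    split_ifs with hX hY hY
    · exact ih h
    · exact (ih (h.trans Finset.subset_union_right)).cons c
    · exact absurd (hY.mono_right h) hX
    · exact (ih (Finset.union_subset_union_right h)).cons_cons c

theorem influencing_append (F l : List (V × V)) (X : Finset V) :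
    influencing (F ++ l) X = influencing F X ++ influencing l (reach F X) := by
  induction F generalizing X with
  | nil => rfl
  | cons c F ih =>
    rw [List.cons_append, influencing, influencing, reach_cons, sources]
    split_ifs
    · exact ih X
    · rw [ih, List.cons_append]

theorem reach_eq_union_participants (l : List (V × V)) (X : Finset V) :
    reach l X = X ∪ participants (influencing l X) := by
  induction l generalizing X with
  | nil => exact (Finset.union_empty X).symm
  | cons c l ih =>
    rw [reach_cons, ih, influencing, sources]
    split_ifs
    · rfl
    · rw [participants_cons, ← Finset.union_assoc, Finset.union_comm X]

theorem mem_participants_influencing (l : List (V × V)) (hv : v ∈ X) :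
    v ∈ participants (influencing l X) ↔ v ∈ participants l := by
  induction l generalizing X with
  | nil => rfl
  | cons c l ih =>
    rw [influencing, participants_cons, Finset.mem_union]
    split_ifs with h
    · rw [ih hv, or_iff_right (Finset.disjoint_right.1 h hv)]
    · rw [participants_cons, Finset.mem_union, ih (Finset.mem_union_right _ hv)]

theorem sdiff_participants_influencing (l : List (V × V)) (h : X ⊆ Y) :
    X \ participants (influencing l Y) = X \ participants l := by
  ext v
  simp only [Finset.mem_sdiff]
  exact and_congr_right fun hv => not_congr (mem_participants_influencing l (h hv))

theorem card_reach (l : List (V × V)) (X : Finset V) :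
    (reach l X).card = (X \ participants l).card + (participants (influencing l X)).card := by
  rw [reach_eq_union_participants, ← Finset.card_sdiff_add_card,
    sdiff_participants_influencing l subset_rfl]

theorem influenceCount_cons_of_disjoint (h : Disjoint (ends c) X) :
    influenceCount (c :: l) X = influenceCount l X := by
  rw [influenceCount, influencing_cons_of_disjoint h, influenceCount]

theorem influenceCount_cons_of_not_disjoint (h : ¬Disjoint (ends c) X) :
    influenceCount (c :: l) X = influenceCount l (ends c ∪ X) + 1 := by
  rw [influenceCount, influencing_cons_of_not_disjoint h, List.length_cons, influenceCount]

theorem influenceCount_append (F l : List (V × V)) (X : Finset V) :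
    influenceCount (F ++ l) X = influenceCount F X + influenceCount l (reach F X) := by
  simp only [influenceCount, influencing_append, List.length_append]

theorem influenceCount_le_length (l : List (V × V)) (X : Finset V) :
    influenceCount l X ≤ l.length :=
  (influencing_sublist l X).length_le

theorem influenceCount_mono (l : List (V × V)) (h : X ⊆ Y) :
    influenceCount l X ≤ influenceCount l Y :=
  (influencing_sublist_of_subset l h).length_le

theorem influencing_eq_of_influenceCount_le (h : X ⊆ Y)
    (hle : influenceCount l Y ≤ influenceCount l X) : influencing l X = influencing l Y :=
  (influencing_sublist_of_subset l h).eq_of_length_le hle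

theorem influenceCount_cons_le_cons_iff (hX : ¬Disjoint (ends c) X) (hY : ¬Disjoint (ends c) Y) :
    influenceCount (c :: l) X ≤ influenceCount (c :: l) Y ↔
      influenceCount l (ends c ∪ X) ≤ influenceCount l (ends c ∪ Y) := by
  rw [influenceCount_cons_of_not_disjoint hX, influenceCount_cons_of_not_disjoint hY,
    Nat.succ_le_succ_iff]

theorem not_disjoint_of_influenceCount_cons_le (h : X ⊆ Y) (hY : ¬Disjoint (ends c) Y)
    (hle : influenceCount (c :: l) Y ≤ influenceCount (c :: l) X) : ¬Disjoint (ends c) X := by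
  intro hX
  rw [influenceCount_cons_of_not_disjoint hY, influenceCount_cons_of_disjoint hX] at hle
  have := influenceCount_mono l (h.trans Finset.subset_union_right : X ⊆ ends c ∪ Y)
  omega

theorem card_reach_le (l : List (V × V)) (X : Finset V) :
    (reach l X).card ≤ X.card + influenceCount l X := by
  induction l generalizing X with
  | nil => exact Nat.le_add_right _ _
  | cons c l ih =>
    rw [reach_cons]
    by_cases h : Disjoint (ends c) X
    · rw [sources_of_disjoint h, influenceCount_cons_of_disjoint h]
      exact ih X
    · have hcard := card_sources_le h
      have hrec := ih (sources X c)
      rw [influenceCount_cons_of_not_disjoint h, ← sources_of_not_disjoint h]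
      omega

end Influence

section Clusters

variable {V : Type*} [DecidableEq V] {c : V × V} {F l : List (V × V)} {A B C D O X : Finset V}
  {v : V}

/-- No call of `F` connects a member of `C` with a person outside `C`. -/
def ClosedUnder (F : List (V × V)) (C : Finset V) : Prop :=
  ∀ c ∈ F, Disjoint (ends c) C ∨ ends c ⊆ C

theorem closedUnder_cons :
    ClosedUnder (c :: F) C ↔ (Disjoint (ends c) C ∨ ends c ⊆ C) ∧ ClosedUnder F C :=
  List.forall_mem_cons

theorem closedUnder_append_singleton :
    ClosedUnder (F ++ [c]) C ↔ ClosedUnder F C ∧ (Disjoint (ends c) C ∨ ends c ⊆ C) := by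
  rw [ClosedUnder, List.forall_mem_append, List.forall_mem_singleton, ClosedUnder]

theorem ClosedUnder.union (hA : ClosedUnder F A) (hB : ClosedUnder F B) :
    ClosedUnder F (A ∪ B) := by
  intro c hc
  have hcA := hA c hc
  have hcB := hB c hc
  simp only [disjoint_ends, ends_subset, Finset.mem_union] at *
  tauto

theorem ClosedUnder.sdiff (hA : ClosedUnder F A) (hB : ClosedUnder F B) :
    ClosedUnder F (A \ B) := by
  intro c hc
  have hcA := hA c hc
  have hcB := hB c hc
  simp only [disjoint_ends, ends_subset, Finset.mem_sdiff] at *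
  tauto

theorem ClosedUnder.reach_eq (h : ClosedUnder F C) : reach F C = C := by
  induction F with
  | nil => rfl
  | cons c F ih =>
    obtain ⟨hc, hF⟩ := closedUnder_cons.1 h
    have hsources : sources C c = C := by
      rcases hc with hc | hc
      · exact sources_of_disjoint hc
      · rw [sources, Finset.union_eq_right.2 hc, ite_self]
    rw [reach_cons, hsources, ih hF]

theorem ClosedUnder.disjoint_reach (h : ClosedUnder F C) (hX : Disjoint X C) :
    Disjoint (reach F X) C := by
  induction F generalizing X with
  | nil => exact hX
  | cons c F ih =>
    obtain ⟨hc, hF⟩ := closedUnder_cons.1 h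
    rw [reach_cons]
    refine ih hF ?_
    unfold sources
    split_ifs with hcX
    · exact hX
    · refine Finset.disjoint_union_left.2 ⟨hc.resolve_right fun hsub => hcX ?_, hX⟩
      exact (hX.mono_right hsub).symm

theorem ClosedUnder.influenceCount_union (h : ClosedUnder F C) (hX : Disjoint X C) :
    influenceCount F (X ∪ C) = influenceCount F X + influenceCount F C := by
  induction F generalizing X with
  | nil => rfl
  | cons c F ih =>
    obtain ⟨hc, hF⟩ := closedUnder_cons.1 h
    by_cases hcX : Disjoint (ends c) X
    · by_cases hcC : Disjoint (ends c) C
      · rw [influenceCount_cons_of_disjoint (Finset.disjoint_union_right.2 ⟨hcX, hcC⟩),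
          influenceCount_cons_of_disjoint hcX, influenceCount_cons_of_disjoint hcC, ih hF hX]
      · have hsub : ends c ∪ C = C := Finset.union_eq_right.2 (hc.resolve_left hcC)
        rw [influenceCount_cons_of_not_disjoint (by simp [Finset.disjoint_union_right, hcC]),
          influenceCount_cons_of_disjoint hcX, influenceCount_cons_of_not_disjoint hcC,
          Finset.union_left_comm, hsub, ih hF hX, add_assoc]
    · have hcC : Disjoint (ends c) C :=
        hc.resolve_right fun hsub => hcX (hX.mono_right hsub).symm
      rw [influenceCount_cons_of_not_disjoint (by simp [Finset.disjoint_union_right, hcX]),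
        influenceCount_cons_of_not_disjoint hcX, influenceCount_cons_of_disjoint hcC,
        ← Finset.union_assoc, ih hF (Finset.disjoint_union_left.2 ⟨hcC, hX⟩), add_right_comm]

/-- `Cluster F C`: the calls of `F` (latest call first) that have a participant in `C` form a
spanning tree of `C`. The tree is grown backwards in time, by merging two clusters whenever a call
connects them. -/
inductive Cluster : List (V × V) → Finset V → Prop
  | singleton (v : V) : Cluster [] {v}
  | skip {F : List (V × V)} {C : Finset V} {c : V × V} (hC : Cluster F C)
      (hc : Disjoint (ends c) C) : Cluster (F ++ [c]) C
  | merge {F : List (V × V)} {A B : Finset V} {c : V × V} (hA : Cluster F A) (hB : Cluster F B)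
      (hAB : Disjoint A B) (h1 : c.1 ∈ A) (h2 : c.2 ∈ B) : Cluster (F ++ [c]) (A ∪ B)

theorem Cluster.nonempty (h : Cluster F C) : C.Nonempty := by
  induction h with
  | singleton v => exact Finset.singleton_nonempty v
  | skip _ _ ih => exact ih
  | merge _ _ _ _ _ ihA => exact ihA.mono Finset.subset_union_left

theorem Cluster.closedUnder (h : Cluster F C) : ClosedUnder F C := by
  induction h with
  | singleton v => exact List.forall_mem_nil _
  | skip _ hc ih => exact closedUnder_append_singleton.2 ⟨ih, Or.inl hc⟩
  | merge _ _ _ h1 h2 ihA ihB =>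
    exact closedUnder_append_singleton.2 ⟨ihA.union ihB, Or.inr (ends_subset.2
      ⟨Finset.mem_union_left _ h1, Finset.mem_union_right _ h2⟩)⟩

theorem Cluster.influenceCount_add_one (h : Cluster F C) : influenceCount F C + 1 = C.card := by
  induction h with
  | singleton v => rfl
  | skip hC hc ih =>
    rw [influenceCount_append, hC.closedUnder.reach_eq, influenceCount_cons_of_disjoint hc]
    exact ih
  | @merge F A B c hA hB hAB h1 _ ihA ihB =>
    have hc : ¬Disjoint (ends c) (A ∪ B) := by simp [disjoint_ends, h1]
    rw [influenceCount_append, hB.closedUnder.influenceCount_union hAB,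
      (hA.closedUnder.union hB.closedUnder).reach_eq, influenceCount_cons_of_not_disjoint hc,
      Finset.card_union_of_disjoint hAB, ← ihA, ← ihB]
    simp only [influenceCount, influencing, List.length_nil]
    omega

theorem Cluster.subset_of_closedUnder (hC : Cluster F C) (hD : ClosedUnder F D)
    (h : ¬Disjoint C D) : C ⊆ D := by
  induction hC with
  | singleton v => simpa using h
  | skip _ _ ih => exact ih (closedUnder_append_singleton.1 hD).1 h
  | merge _ _ _ h1 h2 ihA ihB =>
    obtain ⟨hF, hc⟩ := closedUnder_append_singleton.1 hD
    rw [disjoint_ends, ends_subset] at hc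
    have hA := ihA hF
    have hB := ihB hF
    rw [Finset.disjoint_union_left] at h
    simp only [Finset.not_disjoint_iff] at hA hB
    grind

theorem Cluster.eq_of_not_disjoint (hC : Cluster F C) (hD : Cluster F D) (h : ¬Disjoint C D) :
    C = D :=
  (hC.subset_of_closedUnder hD.closedUnder h).antisymm
    (hD.subset_of_closedUnder hC.closedUnder fun hDC => h hDC.symm)

/-- A call has only two participants, so one of them lies in two of the sets `A`, `B` and `O`. -/
theorem not_disjoint_ends_inter (hO : O ∩ (A ∪ B) ⊆ A ∩ B) (hcA : ¬Disjoint (ends c) A)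
    (hcB : ¬Disjoint (ends c) B) (hcO : ¬Disjoint (ends c) O) : ¬Disjoint (ends c) (A ∩ B) := by
  have hO1 := @hO c.1
  have hO2 := @hO c.2
  simp only [disjoint_ends, Finset.mem_inter, Finset.mem_union] at *
  tauto

theorem influenceCount_union_le_inter (l : List (V × V)) (hO : O ∩ (A ∪ B) ⊆ A ∩ B)
    (hA : influenceCount l (A ∪ B) ≤ influenceCount l A)
    (hB : influenceCount l (A ∪ B) ≤ influenceCount l B)
    (hABO : influenceCount l (A ∪ B ∪ O) ≤ influenceCount l O) :
    influenceCount l (A ∪ B) ≤ influenceCount l (A ∩ B) := by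
  induction l generalizing A B O with
  | nil => exact le_rfl
  | cons c l ih =>
    by_cases hc : Disjoint (ends c) (A ∪ B)
    · obtain ⟨hcA, hcB⟩ := Finset.disjoint_union_right.1 hc
      rw [influenceCount_cons_of_disjoint hc, influenceCount_cons_of_disjoint hcA] at hA
      rw [influenceCount_cons_of_disjoint hc, influenceCount_cons_of_disjoint hcB] at hB
      rw [influenceCount_cons_of_disjoint hc,
        influenceCount_cons_of_disjoint (hcA.mono_right Finset.inter_subset_left)]
      by_cases hcO : Disjoint (ends c) O
      · rw [influenceCount_cons_of_disjoint (Finset.disjoint_union_right.2 ⟨hc, hcO⟩),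
          influenceCount_cons_of_disjoint hcO] at hABO
        exact ih hO hA hB hABO
      · rw [influenceCount_cons_of_not_disjoint (by simp [Finset.disjoint_union_right, hcO]),
          influenceCount_cons_of_not_disjoint hcO, Finset.union_left_comm] at hABO
        refine ih (O := ends c ∪ O) ?_ hA hB (Nat.le_of_succ_le_succ hABO)
        rwa [Finset.union_inter_distrib_right, Finset.disjoint_iff_inter_eq_empty.1 hc,
          Finset.empty_union]
    · have hcA := not_disjoint_of_influenceCount_cons_le Finset.subset_union_left hc hA
      have hcB := not_disjoint_of_influenceCount_cons_le Finset.subset_union_right hc hB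
      have hcABO : ¬Disjoint (ends c) (A ∪ B ∪ O) :=
        mt (Disjoint.mono_right Finset.subset_union_left) hc
      have hcO := not_disjoint_of_influenceCount_cons_le Finset.subset_union_right hcABO hABO
      rw [influenceCount_cons_le_cons_iff hc hcA, Finset.union_union_distrib_left] at hA
      rw [influenceCount_cons_le_cons_iff hc hcB, Finset.union_union_distrib_left] at hB
      rw [influenceCount_cons_le_cons_iff hcABO hcO, Finset.union_union_distrib_left,
        Finset.union_union_distrib_left _ A] at hABO
      rw [influenceCount_cons_le_cons_iff hc (not_disjoint_ends_inter hO hcA hcB hcO),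
        Finset.union_union_distrib_left, Finset.union_inter_distrib_left]
      refine ih ?_ hA hB hABO
      rw [← Finset.union_union_distrib_left, ← Finset.union_inter_distrib_left,
        ← Finset.union_inter_distrib_left]
      exact Finset.union_subset_union_right hO

end Clusters

section ClusterBound

variable {k f w τ φ f₁ w₁ τ₁ f₂ w₂ τ₂ : ℕ}

/-- The lower bound on the number `f` of members of a cluster that make no earlier calls, in terms
of the number `w` of earlier calls that influence the cluster and the number `τ` of participants of
these calls. The difference `τ - w` is truncated at `0`. -/
def ClusterBound (k f w τ : ℕ) : Prop :=
  w < k → 2 ^ (k - 1 - w) ≤ f + min 2 (τ - w)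

theorem ClusterBound.of_le_add (hw : k ≤ w + 1) (h : k ≤ f + τ) : ClusterBound k f w τ := by
  intro _
  rw [show k - 1 - w = 0 by omega, pow_zero]
  omega

theorem ClusterBound.of_left_le (h₁ : ClusterBound k f₁ w₁ τ₁) (hw₁ : w₁ ≤ w) (hw : w + 2 ≤ k)
    (h₂ : k ≤ f₂ + φ + τ) : ClusterBound k (f₁ + f₂ + φ) w τ := by
  intro _
  have hpow : 2 ^ (k - 1 - w) ≤ 2 ^ (k - 1 - w₁) := Nat.pow_le_pow_right two_pos (by omega)
  have hbound := h₁ (by omega)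
  omega

theorem ClusterBound.add (h₁ : ClusterBound k f₁ (w + 1) (τ + φ))
    (h₂ : ClusterBound k f₂ (w + 1) (τ + φ)) (hw : w + 2 ≤ k)
    (hτ : τ + φ ≤ w + 2) : ClusterBound k (f₁ + f₂ + φ) w τ := by
  intro _
  have hbound₁ := h₁ hw
  have hbound₂ := h₂ hw
  rw [show k - 1 - w = k - 1 - (w + 1) + 1 by omega, pow_succ]
  omega

/-- The bound for a cluster that arises by merging two clusters through a call, `φ` being the number
of participants of this call that make no earlier calls. -/
theorem ClusterBound.merge (h₁ : ClusterBound k f₁ w₁ τ₁) (h₂ : ClusterBound k f₂ w₂ τ₂)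
    (hw₁ : w₁ ≤ w + 1) (hw₂ : w₂ ≤ w + 1) (hk₁ : k ≤ f₁ + φ + τ) (hk₂ : k ≤ f₂ + φ + τ)
    (h : w₁ = w + 1 → w₂ = w + 1 → τ₁ = τ + φ ∧ τ₂ = τ + φ ∧ τ + φ ≤ w + 2) :
    ClusterBound k (f₁ + f₂ + φ) w τ := by
  rcases le_or_gt k (w + 1) with hk | hk
  · exact .of_le_add hk (by omega)
  rcases hw₁.eq_or_lt with rfl | hlt₁
  · rcases hw₂.eq_or_lt with rfl | hlt₂
    · obtain ⟨rfl, rfl, hτ⟩ := h rfl rfl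
      exact h₁.add h₂ hk hτ
    · rw [add_comm f₁]
      exact h₂.of_left_le (Nat.le_of_lt_succ hlt₂) hk hk₁
  · exact h₁.of_left_le (Nat.le_of_lt_succ hlt₁) hk hk₂

end ClusterBound

section LowerBound

variable {V : Type*} [DecidableEq V] {c : V × V} {F l r : List (V × V)} {A B C L : Finset V}
  {v : V} {k j : ℕ}

/-- `L` is a minimal set of persons that know `k` gossips each and that are influenced by fewer than
`L.card + j` calls. -/
structure Critical (r : List (V × V)) (k j : ℕ) (L : Finset V) : Prop where
  le_card_reach : ∀ v ∈ L, k ≤ (reach r {v}).card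
  influenceCount_lt : influenceCount r L < L.card + j
  le_influenceCount : ∀ L' ⊂ L, L'.Nonempty → L'.card + j ≤ influenceCount r L'

theorem Critical.le_card_reach_of_mem (hL : Critical (F ++ l) k j L) (hC : ClosedUnder F C)
    (hCL : C ⊆ L) (hv : v ∈ C) : k ≤ (reach l C).card := by
  refine (hL.le_card_reach v (hCL hv)).trans (Finset.card_le_card ?_)
  rw [reach_append]
  calc reach l (reach F {v}) ⊆ reach l (reach F C) :=
        reach_mono l (reach_mono F (Finset.singleton_subset_iff.2 hv))
    _ = reach l C := by rw [hC.reach_eq]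

theorem Critical.influenceCount_reach_le_sdiff (hL : Critical (F ++ l) k j L) (hC : Cluster F C)
    (hCL : C ⊂ L) : influenceCount l (reach F L) ≤ influenceCount l (reach F (L \ C)) := by
  have hcompl := hL.le_influenceCount (L \ C) (Finset.sdiff_ssubset hCL.1 hC.nonempty)
    (Finset.sdiff_nonempty.2 hCL.2)
  have htotal := hL.influenceCount_lt
  have hsplit : influenceCount F L = influenceCount F (L \ C) + influenceCount F C := by
    rw [← hC.closedUnder.influenceCount_union Finset.sdiff_disjoint,
      Finset.sdiff_union_of_subset hCL.1]
  have htree := hC.influenceCount_add_one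
  have hcard := Finset.card_sdiff_add_card_eq_card hCL.1
  rw [influenceCount_append] at hcompl htotal
  omega

theorem Critical.not_disjoint_ends_sdiff (hL : Critical (F ++ c :: l) k j L)
    (hF : ClosedUnder F L) (hC : Cluster F C) (hCL : C ⊂ L) (hc : ¬Disjoint (ends c) L) :
    ¬Disjoint (ends c) (L \ C) := by
  have hle := hL.influenceCount_reach_le_sdiff hC hCL
  rw [hF.reach_eq, (hF.sdiff hC.closedUnder).reach_eq] at hle
  exact not_disjoint_of_influenceCount_cons_le Finset.sdiff_subset hc hle

theorem Critical.exists_disjoint_influenceCount_le (hL : Critical (F ++ l) k j L)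
    (hC : Cluster F C) (hCL : C ⊂ L) :
    ∃ O, Disjoint O C ∧ influenceCount l (C ∪ O) ≤ influenceCount l O := by
  refine ⟨reach F (L \ C), hC.closedUnder.disjoint_reach Finset.sdiff_disjoint, ?_⟩
  have hreach : reach F L = C ∪ reach F (L \ C) := by
    conv_lhs => rw [← Finset.union_sdiff_of_subset hCL.1, reach_union, hC.closedUnder.reach_eq]
  exact hreach ▸ hL.influenceCount_reach_le_sdiff hC hCL

theorem card_sdiff_participants_union (hAB : Disjoint A B) (h1 : c.1 ∈ A) (h2 : c.2 ∈ B) :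
    ((A ∪ B) \ participants l).card = (A \ participants (c :: l)).card +
      (B \ participants (c :: l)).card + (ends c \ participants l).card := by
  have hends : ends c ⊆ A ∪ B :=
    ends_subset.2 ⟨Finset.mem_union_left _ h1, Finset.mem_union_right _ h2⟩
  rw [← Finset.card_union_of_disjoint (hAB.mono Finset.sdiff_subset Finset.sdiff_subset),
    ← Finset.union_sdiff_distrib, participants_cons, ← Finset.card_union_of_disjoint]
  · congr 1
    grind
  · rw [Finset.disjoint_left]
    grind

theorem reach_cons_subset (hAC : A ⊆ C) (hc : ends c ⊆ C) :
    reach (c :: l) A ⊆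
      (A \ participants (c :: l)) ∪ (ends c \ participants l) ∪ participants (influencing l C) := by
  intro v hv
  have hvC : v ∈ C ∪ participants (influencing l C) := by
    rw [← reach_eq_union_participants]
    refine reach_mono l ?_ hv
    unfold sources
    split_ifs
    · exact hAC
    · exact Finset.union_subset hc hAC
  have hvA : v ∈ A ∪ participants (c :: l) := by
    rw [reach_eq_union_participants] at hv
    exact Finset.union_subset_union_right
      (participants_subset_of_sublist (influencing_sublist _ _)) hv
  have hCl := @mem_participants_influencing _ _ C v l
  rw [participants_cons] at *
  grind

theorem card_reach_cons_le (hAC : A ⊆ C) (hc : ends c ⊆ C) :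
    (reach (c :: l) A).card ≤ (A \ participants (c :: l)).card + (ends c \ participants l).card +
      (participants (influencing l C)).card :=
  (Finset.card_le_card (reach_cons_subset hAC hc)).trans
    ((Finset.card_union_le _ _).trans (Nat.add_le_add_right (Finset.card_union_le _ _) _))

theorem card_participants_influencing_cons (hA : ¬Disjoint (ends c) A) (hc : ends c ⊆ C)
    (hAC : A ⊆ C) (hle : influenceCount l C < influenceCount (c :: l) A) :
    (participants (influencing (c :: l) A)).card =
      (participants (influencing l C)).card + (ends c \ participants l).card := by
  rw [influenceCount_cons_of_not_disjoint hA, Nat.lt_succ_iff] at hle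
  rw [influencing_cons_of_not_disjoint hA, participants_cons,
    influencing_eq_of_influenceCount_le (Finset.union_subset hc hAC) hle, add_comm,
    ← sdiff_participants_influencing l hc, Finset.card_sdiff_add_card]

/-- If each of the earlier calls that influence `A ∪ B` influences both sides of the call `c`, then
it influences the two participants of `c`, because it also influences the persons outside. -/
theorem Critical.card_participants_add_le (hL : Critical (F ++ c :: l) k j L)
    (hAB : Disjoint A B) (hC : Cluster (F ++ [c]) (A ∪ B)) (hCL : A ∪ B ⊂ L) (h1 : c.1 ∈ A)
    (h2 : c.2 ∈ B) (hA : influenceCount l (A ∪ B) ≤ influenceCount l (ends c ∪ A))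
    (hB : influenceCount l (A ∪ B) ≤ influenceCount l (ends c ∪ B)) :
    (participants (influencing l (A ∪ B))).card + (ends c \ participants l).card ≤
      influenceCount l (A ∪ B) + 2 := by
  have hends : ends c ⊆ A ∪ B :=
    ends_subset.2 ⟨Finset.mem_union_left _ h1, Finset.mem_union_right _ h2⟩
  have hunion : (ends c ∪ A) ∪ (ends c ∪ B) = A ∪ B := by
    rw [← Finset.union_union_distrib_left, Finset.union_eq_right.2 hends]
  have hinter : (ends c ∪ A) ∩ (ends c ∪ B) = ends c := by
    rw [← Finset.union_inter_distrib_left, Finset.disjoint_iff_inter_eq_empty.1 hAB,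
      Finset.union_empty]
  rw [← List.singleton_append, ← List.append_assoc] at hL
  obtain ⟨O, hOC, hO⟩ := hL.exists_disjoint_influenceCount_le hC hCL
  have hle : influenceCount l (A ∪ B) ≤ influenceCount l (ends c) := by
    have hinfluence := influenceCount_union_le_inter (A := ends c ∪ A) (B := ends c ∪ B) (O := O) l
    rw [hunion, hinter, Finset.disjoint_iff_inter_eq_empty.1 hOC] at hinfluence
    exact hinfluence (Finset.empty_subset _) hA hB hO
  have hreach := card_reach_le l (ends c)
  have hcard := card_ends_le c
  have hmono := influenceCount_mono l hends
  rw [card_reach, influencing_eq_of_influenceCount_le hends hle] at hreach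
  omega

theorem Critical.clusterBound_merge (hL : Critical (F ++ c :: l) k j L) (hA : Cluster F A)
    (hB : Cluster F B) (hAB : Disjoint A B) (h1 : c.1 ∈ A) (h2 : c.2 ∈ B) (hCL : A ∪ B ⊂ L)
    (hboundA : ClusterBound k (A \ participants (c :: l)).card (influenceCount (c :: l) A)
      (participants (influencing (c :: l) A)).card)
    (hboundB : ClusterBound k (B \ participants (c :: l)).card (influenceCount (c :: l) B)
      (participants (influencing (c :: l) B)).card) :
    ClusterBound k ((A ∪ B) \ participants l).card (influenceCount l (A ∪ B))
      (participants (influencing l (A ∪ B))).card := by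
  have hAC : A ⊆ A ∪ B := Finset.subset_union_left
  have hBC : B ⊆ A ∪ B := Finset.subset_union_right
  have hends : ends c ⊆ A ∪ B := ends_subset.2 ⟨hAC h1, hBC h2⟩
  have hcA : ¬Disjoint (ends c) A := fun h => (disjoint_ends.1 h).1 h1
  have hcB : ¬Disjoint (ends c) B := fun h => (disjoint_ends.1 h).2 h2
  have hwA := influenceCount_cons_of_not_disjoint (l := l) hcA
  have hwB := influenceCount_cons_of_not_disjoint (l := l) hcB
  have hmonoA := influenceCount_mono l (Finset.union_subset hends hAC)
  have hmonoB := influenceCount_mono l (Finset.union_subset hends hBC)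
  have hkA := hL.le_card_reach_of_mem hA.closedUnder (hAC.trans hCL.1) h1
  have hkB := hL.le_card_reach_of_mem hB.closedUnder (hBC.trans hCL.1) h2
  rw [card_sdiff_participants_union hAB h1 h2]
  refine hboundA.merge hboundB (by omega) (by omega)
    (hkA.trans (card_reach_cons_le hAC hends)) (hkB.trans (card_reach_cons_le hBC hends))
    fun heqA heqB => ⟨?_, ?_, ?_⟩
  · exact card_participants_influencing_cons hcA hends hAC (by omega)
  · exact card_participants_influencing_cons hcB hends hBC (by omega)
  · exact hL.card_participants_add_le hAB (hA.merge hB hAB h1 h2) hCL h1 h2 (by omega) (by omega)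

theorem Critical.clusterBound (hL : Critical (F ++ l) k j L) (hC : Cluster F C) (hCL : C ⊂ L) :
    ClusterBound k (C \ participants l).card (influenceCount l C)
      (participants (influencing l C)).card := by
  induction hC generalizing l with
  | singleton v =>
    have hknows : k ≤ (reach l {v}).card := hL.le_card_reach v (hCL.1 (Finset.mem_singleton_self v))
    have hle := card_reach_le l {v}
    rw [Finset.card_singleton] at hle
    exact .of_le_add (by omega) (hknows.trans (card_reach l {v}).le)
  | @skip F C c _ hc ih =>
    rw [List.append_assoc, List.singleton_append] at hL
    have hbound := ih hL hCL
    rwa [influenceCount_cons_of_disjoint hc, influencing_cons_of_disjoint hc, participants_cons,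
      Finset.sdiff_union_distrib, Finset.sdiff_eq_self_of_disjoint hc.symm,
      Finset.inter_eq_right.2 Finset.sdiff_subset] at hbound
  | @merge F A B c hA hB hAB h1 h2 ihA ihB =>
    rw [List.append_assoc, List.singleton_append] at hL
    exact hL.clusterBound_merge hA hB hAB h1 h2 hCL
      (ihA hL (Finset.subset_union_left.trans_ssubset hCL))
      (ihB hL (Finset.subset_union_right.trans_ssubset hCL))

/-- The calls of `F` (latest call first) split `L` into two clusters. -/
def SplitsInTwo (F : List (V × V)) (L : Finset V) : Prop :=
  ∃ A B, Cluster F A ∧ Cluster F B ∧ Disjoint A B ∧ A ∪ B = L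

/-- The calls of `F` (latest call first) split `L` into clusters, of which there are at least
two. -/
def SplitsProperly (F : List (V × V)) (L : Finset V) : Prop :=
  ∀ v ∈ L, ∃ C, Cluster F C ∧ v ∈ C ∧ C ⊂ L

theorem SplitsProperly.closedUnder (h : SplitsProperly F L) : ClosedUnder F L := by
  intro c hc
  by_contra! hcL
  obtain ⟨v, hv, hvL⟩ := Finset.not_disjoint_iff.1 hcL.1
  obtain ⟨C, hC, hvC, hCL⟩ := h v hvL
  rcases hC.closedUnder c hc with hcC | hcC
  · exact Finset.disjoint_left.1 hcC hv hvC
  · exact hcL.2 (hcC.trans hCL.1)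

theorem SplitsProperly.skip (h : SplitsProperly F L) (hc : Disjoint (ends c) L) :
    SplitsProperly (F ++ [c]) L := by
  intro v hv
  obtain ⟨C, hC, hvC, hCL⟩ := h v hv
  exact ⟨C, hC.skip (hc.mono_right hCL.1), hvC, hCL⟩

theorem SplitsProperly.merge (h : SplitsProperly F L) (hA : Cluster F A) (hB : Cluster F B)
    (hAB : Disjoint A B) (h1 : c.1 ∈ A) (h2 : c.2 ∈ B) (hABL : A ∪ B ⊂ L) :
    SplitsProperly (F ++ [c]) L := by
  intro v hv
  by_cases hvAB : v ∈ A ∪ B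
  · exact ⟨A ∪ B, hA.merge hB hAB h1 h2, hvAB, hABL⟩
  obtain ⟨C, hC, hvC, hCL⟩ := h v hv
  have hCA : Disjoint A C := by
    by_contra hCA
    exact hvAB (Finset.mem_union_left _ (hA.eq_of_not_disjoint hC hCA ▸ hvC))
  have hCB : Disjoint B C := by
    by_contra hCB
    exact hvAB (Finset.mem_union_right _ (hB.eq_of_not_disjoint hC hCB ▸ hvC))
  exact ⟨C, hC.skip (disjoint_ends.2
    ⟨Finset.disjoint_left.1 hCA h1, Finset.disjoint_left.1 hCB h2⟩), hvC, hCL⟩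

theorem Critical.splitsProperly_nil (hL : Critical r k j L) (hjk : j + 2 ≤ k) :
    SplitsProperly [] L := by
  intro v hv
  have hvL : {v} ⊆ L := Finset.singleton_subset_iff.2 hv
  refine ⟨{v}, .singleton v, Finset.mem_singleton_self v, hvL.ssubset_of_ne ?_⟩
  rintro rfl
  have hknows := hL.le_card_reach v hv
  have hlt := hL.influenceCount_lt
  have hle := card_reach_le r {v}
  rw [Finset.card_singleton] at hlt hle
  omega

theorem Critical.exists_clusters_of_call (hL : Critical (F ++ c :: l) k j L)
    (h : SplitsProperly F L) (hc : ¬Disjoint (ends c) L) :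
    ∃ A B, Cluster F A ∧ Cluster F B ∧ Disjoint A B ∧ c.1 ∈ A ∧ c.2 ∈ B ∧ A ∪ B ⊆ L := by
  have hout : ∀ C, Cluster F C → C ⊂ L → ¬Disjoint (ends c) (L \ C) := fun C hC hCL =>
    hL.not_disjoint_ends_sdiff h.closedUnder hC hCL hc
  simp only [disjoint_ends, Finset.mem_sdiff] at hout hc
  have h12 : c.1 ∈ L ∧ c.2 ∈ L := by
    by_cases h1 : c.1 ∈ L
    · obtain ⟨C, hC, h1C, hCL⟩ := h _ h1
      have := hout C hC hCL
      tauto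
    · have h2 : c.2 ∈ L := by tauto
      obtain ⟨C, hC, h2C, hCL⟩ := h _ h2
      have := hout C hC hCL
      tauto
  obtain ⟨A, hA, h1A, hAL⟩ := h _ h12.1
  obtain ⟨B, hB, h2B, hBL⟩ := h _ h12.2
  refine ⟨A, B, hA, hB, ?_, h1A, h2B, Finset.union_subset hAL.1 hBL.1⟩
  by_contra hAB
  have := hout A hA hAL
  rw [← hA.eq_of_not_disjoint hB hAB] at h2B
  tauto

theorem Critical.not_splitsProperly (hL : Critical r k j L) (hne : L.Nonempty) :
    ¬SplitsProperly r L := by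
  intro h
  obtain ⟨v, hv⟩ := hne
  obtain ⟨C, hC, -, hCL⟩ := h v hv
  have htree := hC.influenceCount_add_one
  have hle := hL.le_influenceCount C hCL hC.nonempty
  omega

/-- Tracing back the calls, the clusters in `L` are merged one by one; they cannot remain at least
two in number until the end, because a proper cluster of all calls has too few influencing calls. -/
theorem Critical.exists_splitsInTwo (hL : Critical r k j L) (hjk : j + 2 ≤ k) (hne : L.Nonempty) :
    ∃ F l, r = F ++ l ∧ SplitsInTwo F L := by
  by_contra! hno
  have hsplit : ∀ F l, r = F ++ l → SplitsProperly F L := by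
    intro F
    induction F using List.reverseRecOn with
    | nil => exact fun _ _ => hL.splitsProperly_nil hjk
    | append_singleton F c ih =>
      intro l hr
      rw [List.append_assoc, List.singleton_append] at hr
      have h := ih _ hr
      by_cases hc : Disjoint (ends c) L
      · exact h.skip hc
      obtain ⟨A, B, hA, hB, hAB, h1, h2, hABL⟩ := (hr ▸ hL).exists_clusters_of_call h hc
      refine h.merge hA hB hAB h1 h2 (hABL.ssubset_of_ne fun heq => ?_)
      exact hno F _ hr ⟨A, B, hA, hB, hAB, heq⟩
  exact hL.not_splitsProperly hne (hsplit r [] (List.append_nil r).symm)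

theorem Critical.influenceCount_eq (hL : Critical (F ++ l) k j (A ∪ B)) (hA : Cluster F A)
    (hB : Cluster F B) (hAB : Disjoint A B) (hAL : A ⊂ A ∪ B) (hBL : B ⊂ A ∪ B) :
    influenceCount l A = j + 1 ∧ influenceCount l B = j + 1 ∧ influenceCount l (A ∪ B) = j + 1 := by
  have hleA := hL.le_influenceCount A hAL hA.nonempty
  have hleB := hL.le_influenceCount B hBL hB.nonempty
  have hlt := hL.influenceCount_lt
  have htreeA := hA.influenceCount_add_one
  have htreeB := hB.influenceCount_add_one
  have hmonoA := influenceCount_mono l hAL.1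
  have hmonoB := influenceCount_mono l hBL.1
  rw [influenceCount_append, hA.closedUnder.reach_eq] at hleA
  rw [influenceCount_append, hB.closedUnder.reach_eq] at hleB
  rw [influenceCount_append, hB.closedUnder.influenceCount_union hAB,
    (hA.closedUnder.union hB.closedUnder).reach_eq, Finset.card_union_of_disjoint hAB] at hlt
  omega

theorem Critical.add_two_pow_le_card_reach (hL : Critical (F ++ l) k j (A ∪ B))
    (hA : Cluster F A) (hB : Cluster F B) (hAB : Disjoint A B) (hAL : A ⊂ A ∪ B)
    (hBL : B ⊂ A ∪ B) (hjk : j + 2 ≤ k)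
    (hrec : influenceCount (F ++ l) B < B.card + (j + 1) →
      j + 1 + 2 ^ (k - (j + 1) - 1) ≤ (reach (F ++ l) B).card + 1) :
    j + 2 ^ (k - j - 1) ≤ (reach (F ++ l) (A ∪ B)).card + 1 := by
  obtain ⟨hwA, hwB, hwAB⟩ := hL.influenceCount_eq hA hB hAB hAL hBL
  have hboundA := hL.clusterBound hA hAL
  have hboundB := hL.clusterBound hB hBL
  have htree := hB.influenceCount_add_one
  rw [hwA, influencing_eq_of_influenceCount_le hAL.1 (by omega)] at hboundA
  rw [hwB, influencing_eq_of_influenceCount_le hBL.1 (by omega)] at hboundB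
  rw [influenceCount_append, reach_append, hB.closedUnder.reach_eq, hwB, card_reach,
    influencing_eq_of_influenceCount_le hBL.1 (by omega)] at hrec
  rw [reach_append, (hA.closedUnder.union hB.closedUnder).reach_eq, card_reach,
    Finset.union_sdiff_distrib,
    Finset.card_union_of_disjoint (hAB.mono Finset.sdiff_subset Finset.sdiff_subset)]
  have hrecB := hrec (by omega)
  have hfreeA := hboundA (by omega)
  have hfreeB := hboundB (by omega)
  rw [show k - 1 - (j + 1) = k - j - 2 by omega] at hfreeA hfreeB
  rw [show k - (j + 1) - 1 = k - j - 2 by omega] at hrecB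
  rw [show k - j - 1 = k - j - 2 + 1 by omega, pow_succ]
  omega

theorem add_two_pow_le_card_reach_add_one {r : List (V × V)} (hne : L.Nonempty)
    (hL : ∀ v ∈ L, k ≤ (reach r {v}).card) (hlt : influenceCount r L < L.card + j)
    (hjk : j + 3 ≤ k) : j + 2 ^ (k - j - 1) ≤ (reach r L).card + 1 := by
  induction L using Finset.strongInduction generalizing j with
  | H L ih =>
    rcases hjk.eq_or_lt with rfl | hjk'
    · obtain ⟨v, hv⟩ := hne
      have hle := (hL v hv).trans
        (Finset.card_le_card (reach_mono r (Finset.singleton_subset_iff.2 hv)))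
      rw [show j + 3 - j - 1 = 2 by omega]
      omega
    by_cases hcrit : Critical r k j L
    · obtain ⟨F, l, rfl, A, B, hA, hB, hAB, rfl⟩ := hcrit.exists_splitsInTwo (by omega) hne
      have hAL : A ⊂ A ∪ B := by
        refine Finset.subset_union_left.ssubset_of_ne fun h => ?_
        exact hB.nonempty.ne_empty (hAB.symm.eq_bot_of_le (h ▸ Finset.subset_union_right))
      have hBL : B ⊂ A ∪ B := by
        refine Finset.subset_union_right.ssubset_of_ne fun h => ?_
        exact hA.nonempty.ne_empty (hAB.eq_bot_of_le (h ▸ Finset.subset_union_left))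
      exact hcrit.add_two_pow_le_card_reach hA hB hAB hAL hBL (by omega) fun hltB =>
        ih B hBL hB.nonempty (fun v hv => hL v (hBL.1 hv)) hltB hjk'
    · obtain ⟨L', hL'L, hne', hlt'⟩ :
          ∃ L' ⊂ L, L'.Nonempty ∧ influenceCount r L' < L'.card + j := by
        by_contra! hmin
        exact hcrit ⟨hL, hlt, hmin⟩
      have hrec := ih L' hL'L hne' (fun v hv => hL v (hL'L.1 hv)) hlt' hjk
      exact hrec.trans (Nat.succ_le_succ (Finset.card_le_card (reach_mono r hL'L.1)))

theorem IsInforming.card_add_le_length [Fintype V] [Nonempty V] {s : List (V × V)}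
    (hs : IsInforming k s) (hjk : j + 3 ≤ k) (hV : Fintype.card V + 1 < j + 2 ^ (k - j - 1)) :
    Fintype.card V + j ≤ s.length := by
  by_contra! hlt
  have hcount := influenceCount_le_length s.reverse Finset.univ
  rw [List.length_reverse] at hcount
  have hle := add_two_pow_le_card_reach_add_one (r := s.reverse) Finset.univ_nonempty
    (fun v _ => knowledge_eq_reach s v ▸ hs v) (hcount.trans_lt hlt) hjk
  have hcard := Finset.card_le_univ (reach s.reverse Finset.univ)
  omega

end LowerBound

section UpperBound

variable {V W : Type*} {c : V × V} {s : List (V × V)} {f : V → W} {k : ℕ}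

theorem IsScheme.map (hs : IsScheme s) (hf : f.Injective) :
    IsScheme (s.map (Prod.map f f)) := by
  rintro _ hd
  obtain ⟨c, hc, rfl⟩ := List.mem_map.1 hd
  exact hf.ne (hs c hc)

variable [DecidableEq W] {K : V → Finset V}

/-- In the state of knowledge `K`, the person `v` knows the gossip `z` and at least `k` gossips in
all. If everybody knows `z`, then a single call with `z` informs a newcomer. -/
def Knows (K : V → Finset V) (z : V) (k : ℕ) (v : V) : Prop :=
  z ∈ K v ∧ k ≤ (K v).card

theorem Knows.of_image_subset {K' : W → Finset W} {z v : V} {w : W} (h : Knows K z k v)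
    (hf : f.Injective) (hsub : (K v).image f ⊆ K' w) : Knows K' (f z) k w := by
  refine ⟨hsub (Finset.mem_image_of_mem f h.1), h.2.trans ?_⟩
  exact (Finset.card_image_of_injective _ hf).symm.trans_le (Finset.card_le_card hsub)

theorem Knows.of_insert_image_subset {K' : W → Finset W} {z v : V} {w x : W} (h : Knows K z k v)
    (hf : f.Injective) (hx : x ∉ Set.range f) (hsub : insert x ((K v).image f) ⊆ K' w) :
    Knows K' (f z) (k + 1) w := by
  refine ⟨hsub (Finset.mem_insert_of_mem (Finset.mem_image_of_mem f h.1)), ?_⟩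
  have hx' : x ∉ (K v).image f := fun hmem =>
    hx (Set.mem_range.2 ((Finset.mem_image.1 hmem).imp fun _ => And.right))
  calc k + 1 ≤ ((K v).image f).card + 1 := by
        rw [Finset.card_image_of_injective _ hf]
        exact Nat.succ_le_succ h.2
    _ = (insert x ((K v).image f)).card := (Finset.card_insert_of_notMem hx').symm
    _ ≤ (K' w).card := Finset.card_le_card hsub

variable [DecidableEq V]

theorem subset_call (K : V → Finset V) (c : V × V) (v : V) : K v ⊆ call K c v := by
  unfold call
  split_ifs with h
  · rcases h with rfl | rfl
    · exact Finset.subset_union_left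
    · exact Finset.subset_union_right
  · exact Finset.Subset.refl _

theorem subset_foldl_call (s : List (V × V)) (K : V → Finset V) (v : V) :
    K v ⊆ s.foldl call K v := by
  induction s generalizing K with
  | nil => exact Finset.Subset.refl _
  | cons c _ ih => exact (subset_call K c v).trans (ih _)

theorem union_subset_foldl_call (hc : c ∈ s) (K : V → Finset V) {v : V}
    (hv : v = c.1 ∨ v = c.2) : K c.1 ∪ K c.2 ⊆ s.foldl call K v := by
  induction s generalizing K with
  | nil => exact absurd hc List.not_mem_nil
  | cons d s ih =>
    rcases List.mem_cons.1 hc with rfl | hc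
    · exact (if_pos hv).symm.subset.trans (subset_foldl_call s (call K c) v)
    · exact (Finset.union_subset_union (subset_call K d _) (subset_call K d _)).trans (ih hc _)

theorem biUnion_foldl_call_subset (hf : f.Injective) (g : V → Finset W) (s : List (V × V))
    {K' : W → Finset W} (h : ∀ v, (K v).biUnion g ⊆ K' (f v)) (v : V) :
    (s.foldl call K v).biUnion g ⊆ (s.map (Prod.map f f)).foldl call K' (f v) := by
  induction s generalizing K K' with
  | nil => exact h v
  | cons c _ ih =>
    refine ih fun u => ?_
    simp only [call, Prod.map_fst, Prod.map_snd, hf.eq_iff]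
    split_ifs
    · rw [Finset.union_biUnion]
      exact Finset.union_subset_union (h _) (h _)
    · exact h u

theorem image_knowledge_subset (hf : f.Injective) (s : List (V × V)) (v : V) :
    (knowledge s v).image f ⊆ knowledge (s.map (Prod.map f f)) (f v) := by
  rw [← Finset.biUnion_singleton]
  exact biUnion_foldl_call_subset hf _ s (fun v => Finset.singleton_biUnion.subset) v

theorem knowledge_append (s s' : List (V × V)) :
    knowledge (s ++ s') = s'.foldl call (knowledge s) :=
  List.foldl_append

theorem insert_none_image_subset (s : List (V × V)) {v z : V} (hz : z ∈ knowledge s v) :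
    insert none ((knowledge s v).image some) ⊆
      knowledge ((none, some z) :: s.map (Prod.map some some)) (some v) := by
  have hfirst (u : V) : ({u} : Finset V).biUnion
      (fun x => if x = z then {some x, none} else {some x}) ⊆
        call (fun w => {w}) (none, some z) (some u) := by
    by_cases hu : u = z <;> simp [call, hu, Finset.pair_comm]
  have hsub := biUnion_foldl_call_subset (Option.some_injective V) _ s hfirst v
  refine Finset.insert_subset (hsub ?_) (Finset.image_subset_iff.2 fun u hu => hsub ?_)
  · exact Finset.mem_biUnion.2 ⟨z, hz, by simp⟩
  · exact Finset.mem_biUnion.2 ⟨u, hu, by split_ifs <;> simp⟩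

theorem insert_inr_image_inl_subset [Fintype V] (s : List (V × V)) {v : V} {w : V ⊕ V}
    (hw : w = .inl v ∨ w = .inr v) :
    insert (.inr v) ((knowledge s v).image .inl) ⊆ knowledge (s.map (Prod.map .inl .inl) ++
      Finset.univ.toList.map fun u => (.inl u, .inr u)) w := by
  rw [knowledge_append]
  refine Finset.Subset.trans ?_ (union_subset_foldl_call
    (List.mem_map.2 ⟨v, Finset.mem_toList.2 (Finset.mem_univ v), rfl⟩) _ hw)
  refine Finset.insert_subset (Finset.mem_union_right _ ?_)
    ((image_knowledge_subset Sum.inl_injective s v).trans Finset.subset_union_left)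
  exact subset_foldl_call _ _ _ (Finset.mem_singleton_self _)

theorem Knows.call_newcomer {K : Option V → Finset (Option V)} {z : V}
    (h : ∀ v, Knows K (some z) k (some v)) (w : Option V) :
    Knows (call K (none, some z)) (some z) k w := by
  obtain ⟨v, hv⟩ : ∃ v, K (some v) ⊆ call K (none, some z) w := by
    cases w with
    | none => exact ⟨z, Finset.subset_union_right.trans (if_pos (Or.inl rfl)).symm.subset⟩
    | some v => exact ⟨v, subset_call K _ _⟩
  exact ⟨hv (h v).1, (h v).2.trans (Finset.card_le_card hv)⟩

/-- Some `m` calls among `n` persons give every person at least `k` gossips, and one and the same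
gossip to everybody. The persons form an arbitrary type, so that `Option V` and `V ⊕ V` can serve
as larger groups. -/
def Attainable (n m k : ℕ) : Prop :=
  ∃ (V : Type) (_ : Fintype V) (_ : DecidableEq V) (s : List (V × V)) (z : V),
    Fintype.card V = n ∧ IsScheme s ∧ s.length = m ∧ ∀ v, Knows (knowledge s) z k v

namespace Attainable

variable {n m : ℕ}

theorem four : Attainable 4 4 4 := by
  refine ⟨Fin 4, inferInstance, inferInstance, [(0, 1), (2, 3), (0, 2), (1, 3)], 0,
    Fintype.card_fin 4, ?_, rfl, ?_⟩
  · unfold IsScheme; decide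
  · unfold Knows; decide

theorem exists_isInforming (h : Attainable n m k) :
    ∃ s : List (Fin n × Fin n), IsScheme s ∧ IsInforming k s ∧ s.length = m := by
  obtain ⟨V, _, _, s, z, hn, hs, hm, hk⟩ := h
  have e : V ≃ Fin n := Fintype.equivFinOfCardEq hn
  refine ⟨s.map (Prod.map e e), hs.map e.injective, e.surjective.forall.2 fun v => ?_,
    by rwa [List.length_map]⟩
  exact ((hk v).of_image_subset e.injective (image_knowledge_subset e.injective s v)).2

theorem join (h : Attainable n m k) : Attainable (n + 1) (m + 1) k := by
  obtain ⟨V, _, _, s, z, hn, hs, hm, hk⟩ := h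
  have hsome := Option.some_injective V
  refine ⟨Option V, inferInstance, inferInstance, s.map (Prod.map some some) ++ [(none, some z)],
    some z, by rw [Fintype.card_option, hn], ?_, by simp [hm], ?_⟩
  · exact List.forall_mem_append.2 ⟨hs.map hsome, by simp⟩
  · rw [knowledge_append]
    exact Knows.call_newcomer fun v =>
      (hk v).of_image_subset hsome (image_knowledge_subset hsome s v)

theorem join_twice (h : Attainable n m k) : Attainable (n + 1) (m + 2) (k + 1) := by
  obtain ⟨V, _, _, s, z, hn, hs, hm, hk⟩ := h
  have hsome := Option.some_injective V
  refine ⟨Option V, inferInstance, inferInstance,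
    (none, some z) :: s.map (Prod.map some some) ++ [(none, some z)], some z,
    by rw [Fintype.card_option, hn], ?_, by simp [hm], ?_⟩
  · exact List.forall_mem_append.2 ⟨List.forall_mem_cons.2 ⟨by simp, hs.map hsome⟩, by simp⟩
  · rw [knowledge_append]
    exact Knows.call_newcomer fun v => (hk v).of_insert_image_subset hsome (by simp)
      (insert_none_image_subset s (hk v).1)

theorem double (h : Attainable n m k) : Attainable (2 * n) (m + n) (k + 1) := by
  obtain ⟨V, _, _, s, z, hn, hs, hm, hk⟩ := h
  have hinl : Function.Injective (Sum.inl : V → V ⊕ V) := Sum.inl_injective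
  refine ⟨V ⊕ V, inferInstance, inferInstance,
    s.map (Prod.map .inl .inl) ++ Finset.univ.toList.map fun v => (.inl v, .inr v), .inl z,
    by rw [Fintype.card_sum, hn, two_mul], ?_, by simp [hm, hn], fun w => ?_⟩
  · exact List.forall_mem_append.2 ⟨hs.map hinl, by simp⟩
  · obtain ⟨v, hv⟩ : ∃ v, w = .inl v ∨ w = .inr v := by cases w <;> simp
    exact (hk v).of_insert_image_subset hinl (by simp) (insert_inr_image_inl_subset s hv)

theorem two_pow (p : ℕ) : Attainable (2 ^ (p + 2)) (2 ^ (p + 2)) (p + 4) := by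
  induction p with
  | zero => exact four
  | succ p ih => simpa only [← two_mul, ← pow_succ'] using ih.double

theorem two_pow_add (p i : ℕ) :
    Attainable (2 ^ (p + 2) + i) (2 ^ (p + 2) + i + i) (p + 4 + i) := by
  induction i with
  | zero => exact two_pow p
  | succ i ih => convert ih.join_twice using 1 <;> ring

theorem of_le {p i : ℕ} (h : 2 ^ (p + 2) + i ≤ n) : Attainable n (n + i) (p + 4 + i) := by
  induction n, h using Nat.le_induction with
  | base => exact two_pow_add p i
  | succ n _ ih => simpa only [Nat.add_right_comm] using ih.join

end Attainable

end UpperBound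

theorem t_eq_add_two_pow {k q : ℕ} {i : ℤ} (hk : (k : ℤ) = i + 2 + q) : t k i = i + 2 ^ q := by
  rw [t, show (k : ℤ) - i - 2 = q by omega, Int.toNat_natCast]

end PartialGossip

theorem theorem1 (n k : ℕ) (i : ℕ) (hi : (i : ℤ) ≤ (k : ℤ) - 4)
    (hlow : PartialGossip.t k (i : ℤ) ≤ (n : ℤ))
    (hupp : (n : ℤ) < PartialGossip.t k ((i : ℤ) - 1)) :
    PartialGossip.P n k = n + i := by
  obtain ⟨p, rfl⟩ : ∃ p, k = p + 4 + i := ⟨k - 4 - i, by omega⟩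
  rw [PartialGossip.t_eq_add_two_pow (q := p + 2) (by push_cast; ring)] at hlow
  rw [PartialGossip.t_eq_add_two_pow (q := p + 3) (by push_cast; ring)] at hupp
  have hlow' : 2 ^ (p + 2) + i ≤ n := by zify; linarith
  have hupp' : n + 1 < i + 2 ^ (p + 3) := by zify; linarith
  have : Nonempty (Fin n) := ⟨⟨0, (by positivity : 0 < 2 ^ (p + 2) + i).trans_le hlow'⟩⟩
  refine IsLeast.csInf_eq ⟨(PartialGossip.Attainable.of_le hlow').exists_isInforming, ?_⟩
  rintro m ⟨s, -, hs, rfl⟩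
  have hlength := hs.card_add_le_length (j := i) (by omega) (by
    rwa [Fintype.card_fin, show p + 4 + i - i - 1 = p + 3 by omega])
  rwa [Fintype.card_fin] at hlength
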